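/- **Setting.** A scalar field $(\mathbb X,f)$ is a topological space with a continuous function $f:\mathbb X\to\mathbb R$. It is *constructible* if, by a homeomorphism preserving the functions, it is obtained from finitely many critical values $a_0<\dots<a_n$, compact locally path-connected spaces $\mathbb V_i$ ($0\le i\le n$) and $\mathbb E_i$ ($0\le i<n$), by gluing the cylinders $\mathbb E_i\times[a_i,a_{i+1}]$ to the fibers $\mathbb V_i\times\{a_i\}$ and $\mathbb V_{i+1}\times\{a_{i+1}\}$ along continuous attaching maps $\mathbb E_i\to\mathbb V_i$ and $\mathbb E_i\to\mathbb V_{i+1}$, the function being the projection to the second coordinate. The Reeb graph $\mathcal R_f$ is the quotient space of $\mathbb X$ that identifies two points when they lie in the same connected component of the same level set, with the induced function, again denoted $f$. *Functional distortion distance.* On a path-connected Reeb graph put $d_f(u,v)=\inf_\pi(\max_\pi f-\min_\pi f)$ over all continuous paths $\pi$ from $u$ to $v$. For path-connected $\mathcal R_f,\mathcal R_g$ and continuous maps $\Phi:\mathcal R_f\to\mathcal R_g$, $\Psi:\mathcal R_g\to\mathcal R_f$, let $G(\Phi,\Psi)=\{(x,\Phi(x))\}\cup\{(\Psi(y),y)\}$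 and $$D(\Phi,\Psi)=\sup_{(x,y),(x',y')\in G(\Phi,\Psi)}\tfrac12\,|d_f(x,x')-d_g(y,y')|,$$ $$d_{FD}(\mathcal R_f,\mathcal R_g)=\inf_{\Phi,\Psi}\max\{D(\Phi,\Psi),\|f-g\circ\Phi\|_\infty,\|f\circ\Psi-g\|_\infty\}.$$ In general $d_{FD}(\mathcal R_f,\mathcal R_g)$ is the infimum, over all bijections $\sigma$ between the sets of path components, of the maximum over $i$ of $d_{FD}(\mathcal R_f^i,\mathcal R_g^{\sigma(i)})$; it is $+\infty$ if there is no bijection. *$\mathrm{Ext}_0$.* Fix a field $k$ of coefficients for homology. $\mathrm{Ext}_0(f)$ is the multiset of pairs $(a,b)$ recording the classes in the extended persistence sequence of the Reeb graph that are born at $a$ in the upward sweep $H_0((\mathcal R_f)_{\le s})$ and die at $b$ in the downward sweep $H_0(\mathcal R_f,(\mathcal R_f)_{\ge t})$. Write $d_b^{\mathrm{Ext}_0}(\mathcal R_f,\mathcal R_g)$ for the (ungraded) bottleneck distance between $\mathrm{Ext}_0(f)$ and $\mathrm{Ext}_0(g)$: the infimum, over all bijections between subsets of the off-diagonal points of the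 two diagrams, of the supremum of the $\ell^\infty$-distances between matched points and of the values $\frac12|x_1-x_2|$ for unmatched points $(x_1,x_2)$. **Proposition.** The functional distortion distance is more discriminative than $d_b^{\mathrm{Ext}_0}$, with constant $1$. That is: 1. For all constructible scalar fields $(\mathbb X,f)$ and $(\mathbb Y,g)$, $$d_b^{\mathrm{Ext}_0}(\mathcal R_f,\mathcal R_g)\le d_{FD}(\mathcal R_f,\mathcal R_g).$$ 2. If moreover $\mathcal R_f$ and $\mathcal R_g$ are connected, $v_0,v_1$ are points of global minimum and maximum on $\mathcal R_f$, and $u_0,u_1$ are points of global minimum and maximum on $\mathcal R_g$, then $$d_{FD}(\mathcal R_f,\mathcal R_g)\ge\max\{|f(v_1)-g(u_1)|,\,|f(v_0)-g(u_0)|\}.$$ 3. There is no constant $c'\ge 0$ such that $d_b^{\mathrm{Ext}_0}(\mathcal R_f,\mathcal R_g)=c'\,d_{FD}(\mathcal R_f,\mathcal R_g)$ for all constructible $(\mathbb X,f)$, $(\mathbb X,g)$ on a common path-connected space. -/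

import Mathlib

open scoped ENNReal NNReal

universe u v

/-! ### Constructible scalar fields -/

/-- Gluing data for a constructible scalar field: critical values `a 0 < ⋯ < a n`, critical fibers
`V i`, non-critical fibers `E i` (compact and locally path-connected), and continuous attaching
maps from `E i` to the two neighbouring critical fibers. -/
structure ConstructibleData : Type (u + 1) where
  n : ℕ
  a : Fin (n + 1) → ℝ
  strictMono_a : StrictMono a
  V : Fin (n + 1) → Type u
  E : Fin n → Type u
  [topV : ∀ i, TopologicalSpace (V i)]
  [topE : ∀ i, TopologicalSpace (E i)]
  [compactV : ∀ i, CompactSpace (V i)]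
  [compactE : ∀ i, CompactSpace (E i)]
  [locV : ∀ i, LocallyPathConnectedSpace (V i)]
  [locE : ∀ i, LocallyPathConnectedSpace (E i)]
  lower : ∀ i : Fin n, C(E i, V i.castSucc)
  upper : ∀ i : Fin n, C(E i, V i.succ)

namespace ConstructibleData

attribute [instance] topV topE compactV compactE locV locE

variable (D : ConstructibleData.{u})

/-- The disjoint union of the critical fibers (`V i` stands for `V i × {a i}`) and of the
cylinders `E i × [a i, a (i + 1)]`. -/
abbrev Pieces : Type u :=
  (Σ i, D.V i) ⊕ (Σ i : Fin D.n, D.E i × Set.Icc (D.a i.castSucc) (D.a i.succ))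

/-- The identifications made by the attaching maps at both ends of each cylinder. -/
inductive Glue : D.Pieces → D.Pieces → Prop
  | lower (i : Fin D.n) (e : D.E i)
      (t : Set.Icc (D.a i.castSucc) (D.a i.succ)) (ht : (t : ℝ) = D.a i.castSucc) :
      Glue (Sum.inr ⟨i, e, t⟩) (Sum.inl ⟨i.castSucc, D.lower i e⟩)
  | upper (i : Fin D.n) (e : D.E i)
      (t : Set.Icc (D.a i.castSucc) (D.a i.succ)) (ht : (t : ℝ) = D.a i.succ) :
      Glue (Sum.inr ⟨i, e, t⟩) (Sum.inl ⟨i.succ, D.upper i e⟩)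

/-- The glued space, with the quotient topology. -/
abbrev Space : Type u := Quot D.Glue

/-- Projection to the second coordinate, on the pieces. -/
def pieceHeight : D.Pieces → ℝ
  | Sum.inl v => D.a v.1
  | Sum.inr e => (e.2.2 : ℝ)

/-- Projection to the second coordinate, on the glued space. -/
def height : D.Space → ℝ :=
  Quot.lift D.pieceHeight (by
    rintro _ _ (⟨i, e, t, ht⟩ | ⟨i, e, t, ht⟩) <;> exact ht)

end ConstructibleData

/-- A scalar field `(X, f)` is constructible if there is a homeomorphism from `X` to a space glued
from finitely many cylinders that carries `f` to the projection to the second coordinate. -/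
def IsConstructible {X : Type u} [TopologicalSpace X] (f : C(X, ℝ)) : Prop :=
  ∃ (D : ConstructibleData.{u}) (h : X ≃ₜ D.Space), ∀ x, D.height (h x) = f x

/-! ### Reeb graphs -/

section Reeb

variable {X : Type*} [TopologicalSpace X]

/-- Two points are equivalent if they have the same value and lie in the same connected component
of their level set. -/
def reebSetoid (f : C(X, ℝ)) : Setoid X where
  r x y := f x = f y ∧ y ∈ connectedComponentIn (f ⁻¹' {f x}) x
  iseqv :=
    { refl := fun _ => ⟨rfl, mem_connectedComponentIn rfl⟩
      symm := by
        rintro x y ⟨h, hy⟩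
        refine ⟨h.symm, ?_⟩
        rw [← h, ← connectedComponentIn_eq hy]
        exact mem_connectedComponentIn rfl
      trans := by
        rintro x y z ⟨h, hy⟩ ⟨h', hz⟩
        refine ⟨h.trans h', ?_⟩
        rwa [connectedComponentIn_eq hy, h] }

/-- The underlying space of the Reeb graph, with the quotient topology. -/
abbrev Reeb (f : C(X, ℝ)) : Type _ := Quotient (reebSetoid f)

/-- The function induced by `f` on the Reeb graph. -/
def reebFun (f : C(X, ℝ)) : C(Reeb f, ℝ) where
  toFun := Quotient.lift f fun _ _ h => h.1
  continuous_toFun := f.continuous.quotient_lift _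

end Reeb

/-! ### The functional distortion distance -/

section FunctionalDistortion

variable {X Y : Type*} [TopologicalSpace X] [TopologicalSpace Y]

/-- The height of a path: the length of the range of `f` along it. -/
noncomputable def pathHeight (f : C(X, ℝ)) {u v : X} (γ : Path u v) : ℝ :=
  (⨆ t, f (γ t)) - ⨅ t, f (γ t)

/-- The distance `d_f(u, v)`: the least height of a path from `u` to `v` (only used on
path-connected spaces). -/
noncomputable def heightDist (f : C(X, ℝ)) (u v : X) : ℝ :=
  ⨅ γ : Path u v, pathHeight f γ

/-- The union of the graphs of `Φ` and `Ψ`. -/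
def supergraph (Φ : C(X, Y)) (Ψ : C(Y, X)) : Set (X × Y) :=
  {p | p.2 = Φ p.1} ∪ {p | p.1 = Ψ p.2}

/-- The point distortion. -/
noncomputable def pointDistortion (f : C(X, ℝ)) (g : C(Y, ℝ)) (p q : X × Y) : ℝ :=
  1 / 2 * |heightDist f p.1 q.1 - heightDist g p.2 q.2|

/-- The map distortion `D(Φ, Ψ)`. -/
noncomputable def mapDistortion (f : C(X, ℝ)) (g : C(Y, ℝ)) (Φ : C(X, Y)) (Ψ : C(Y, X)) : ℝ≥0∞ :=
  ⨆ p ∈ supergraph Φ Ψ, ⨆ q ∈ supergraph Φ Ψ, ENNReal.ofReal (pointDistortion f g p q)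

/-- The functional distortion distance between path-connected `(X, f)` and `(Y, g)`. -/
noncomputable def connFunctionalDistortion (f : C(X, ℝ)) (g : C(Y, ℝ)) : ℝ≥0∞ :=
  ⨅ (Φ : C(X, Y)) (Ψ : C(Y, X)),
    max (mapDistortion f g Φ Ψ)
      (max (⨆ x, ENNReal.ofReal |f x - g (Φ x)|) (⨆ y, ENNReal.ofReal |f (Ψ y) - g y|))

/-- A path component, as a subspace. -/
def pathComp (i : ZerothHomotopy X) : Set X := {x | ZerothHomotopy.mk x = i}

/-- The functional distortion distance, in general: the infimum over all bijections between the
sets of path components (`∞` if there is none) of the largest distance between matched components.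
When both spaces are path-connected, the only bijection matches the whole spaces. -/
noncomputable def functionalDistortion (f : C(X, ℝ)) (g : C(Y, ℝ)) : ℝ≥0∞ :=
  ⨅ σ : ZerothHomotopy X ≃ ZerothHomotopy Y, ⨆ i,
    connFunctionalDistortion (f.restrict (pathComp i)) (g.restrict (pathComp (σ i)))

end FunctionalDistortion

/-! ### The subdiagram `Ext₀` of the extended persistence diagram -/

noncomputable section Persistence

variable (k : Type*) [Field k] {X : Type*} [TopologicalSpace X]

/-- The singular `0`-boundaries: the image of `γ ↦ γ(1) - γ(0)` on singular `1`-chains. -/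
def zeroBoundaries (X : Type*) [TopologicalSpace X] : Submodule k (X →₀ k) :=
  Submodule.span k
    (Set.range fun γ : C(unitInterval, X) => Finsupp.single (γ 1) (1 : k) - Finsupp.single (γ 0) 1)

/-- Singular homology `H₀(X)` with coefficients in `k`. -/
abbrev HZero (X : Type*) [TopologicalSpace X] : Type _ := (X →₀ k) ⧸ zeroBoundaries k X

/-- Relative singular homology `H₀(X, A)`: the singular `0`-chains of `X` modulo the boundaries and
the chains of `A`. -/
abbrev HZeroRel (A : Set X) : Type _ := (X →₀ k) ⧸ (zeroBoundaries k X ⊔ Finsupp.supported k k A)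

/-- The inclusion of `S` in `X` sends boundaries to boundaries. -/
theorem zeroBoundaries_le_comap (S A : Set X) :
    zeroBoundaries k S ≤ (zeroBoundaries k X ⊔ Finsupp.supported k k A).comap
      (Finsupp.lmapDomain k k (Subtype.val : S → X)) := by
  refine Submodule.span_le.2 ?_
  rintro _ ⟨γ, rfl⟩
  refine Submodule.mem_sup_left (Submodule.subset_span ⟨⟨fun t => (γ t : X), by fun_prop⟩, ?_⟩)
  simp [Finsupp.mapDomain_sub, Finsupp.mapDomain_single]

/-- The map `H₀(S) → H₀(X, A)` induced by the inclusion of `S` in `X`. -/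
def hZeroMap (S A : Set X) : HZero k S →ₗ[k] HZeroRel k A :=
  Submodule.mapQ (zeroBoundaries k S) (zeroBoundaries k X ⊔ Finsupp.supported k k A)
    (Finsupp.lmapDomain k k (Subtype.val : S → X)) (zeroBoundaries_le_comap k S A)

/-- The rank of `H₀(X_{≤ s}) → H₀(X, X_{≥ t})` (a persistent Betti number). -/
def extRank (f : C(X, ℝ)) (s t : ℝ) : ℕ :=
  Module.finrank k (LinearMap.range (hZeroMap k (f ⁻¹' Set.Iic s) (f ⁻¹' Set.Ici t)))

/-- The number of independent degree-`0` classes that are born in the upward sweep between `a - ε`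
and `a + ε` and die in the downward sweep between `b + ε` and `b - ε`. -/
def extBoxCount (f : C(X, ℝ)) (a b ε : ℝ) : ℤ :=
  ((extRank k f (a + ε) (b + ε) : ℤ) - extRank k f (a - ε) (b + ε))
    - ((extRank k f (a + ε) (b - ε) : ℤ) - extRank k f (a - ε) (b - ε))

/-- The multiplicity of a pair `p = (birth, death)` in `Ext₀(f)`: the number of classes born and
dying in the box of radius `ε` around `p`, for small `ε`. This number decreases with `ε`, so its
eventual value is its least value. -/
def extZero (f : C(X, ℝ)) (p : ℝ × ℝ) : ℕ :=
  ⨅ ε : {ε : ℝ // 0 < ε}, (extBoxCount k f p.1 p.2 ε).toNat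

end Persistence

/-! ### The bottleneck distance -/

section Bottleneck

/-- The off-diagonal points of a diagram given by its multiplicity function, each point `p` being
repeated `D p` times. -/
abbrev OffDiag (D : ℝ × ℝ → ℕ) : Type := {x : Σ p : ℝ × ℝ, Fin (D p) // x.1.1 ≠ x.1.2}

/-- The cost of leaving a point unmatched. -/
noncomputable def diagCost {D : ℝ × ℝ → ℕ} (x : OffDiag D) : ℝ := 1 / 2 * |x.1.1.1 - x.1.1.2|

/-- The cost of a matching, a bijection `M` between a subset `S` of the off-diagonal points of `D₁`
and a subset `T` of those of `D₂`. The distance on `ℝ × ℝ` is that of the sup norm. -/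
noncomputable def matchingCost {D₁ D₂ : ℝ × ℝ → ℕ} {S : Set (OffDiag D₁)} {T : Set (OffDiag D₂)}
    (M : S ≃ T) : ℝ≥0∞ :=
  max (⨆ x : S, ENNReal.ofReal (dist x.1.1.1 (M x).1.1.1))
    (max (⨆ x ∈ Sᶜ, ENNReal.ofReal (diagCost x)) (⨆ y ∈ Tᶜ, ENNReal.ofReal (diagCost y)))

/-- The (ungraded) bottleneck distance between two diagrams. -/
noncomputable def bottleneckDist (D₁ D₂ : ℝ × ℝ → ℕ) : ℝ≥0∞ :=
  ⨅ (S : Set (OffDiag D₁)) (T : Set (OffDiag D₂)) (M : S ≃ T), matchingCost M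

end Bottleneck

/-! ### The two distances between Reeb graphs -/

section ReebDistances

variable {X Y : Type*} [TopologicalSpace X] [TopologicalSpace Y]

/-- The bottleneck distance between the subdiagrams `Ext₀` of the Reeb graphs of `f` and `g`. -/
noncomputable def reebBottleneckExtZero (k : Type*) [Field k] (f : C(X, ℝ)) (g : C(Y, ℝ)) : ℝ≥0∞ :=
  bottleneckDist (extZero k (reebFun f)) (extZero k (reebFun g))

/-- The functional distortion distance between the Reeb graphs of `f` and `g`. -/
noncomputable def reebFunctionalDistortion (f : C(X, ℝ)) (g : C(Y, ℝ)) : ℝ≥0∞ :=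
  functionalDistortion (reebFun f) (reebFun g)

end ReebDistances

/-!
A constructible space is compact and locally path-connected, and so is its Reeb graph, being a
quotient. Such a space `Z` has finitely many path components, and a continuous `f` attains a minimum
and a maximum on each of them. The map `H₀(Z_{≤ s}) → H₀(Z, Z_{≥ t})` has rank equal to the number
of components that meet `Z_{≤ s}` and miss `Z_{≥ t}` (`finrank_range_hZeroMap`). Hence `Ext₀(f)`
consists of one point `(min, max)` for each path component (`extZero_eq_card`).

For any maps `Φ`, `Ψ` between two spaces, the larger of the two maxima is moved by `Φ` or `Ψ` to a
point whose value is at most the smaller maximum, so the displacement is at least the difference of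
the maxima; the same holds for the minima. This gives the lower bound for connected Reeb graphs. It
also gives the comparison of the distances: a bijection of path components induces a matching of the
diagrams whose cost is bounded by the differences of extrema (`bottleneckDist_extZero_le`).

No constant relates the two distances, already on an interval. The functions `t` and `|2 t - 1|` on
`[0, 1]` have the same extrema, so their diagrams agree, but the two ends of the V-shaped function
lie on the same level and every path between them has height at least `1`, whereas in the Reeb graph
of `t` distances are differences of values; their distortion distance is therefore at least `1 / 4`
(`ofReal_heightDist_le_connFunctionalDistortion`). This would force the constant to be `0`, while
`t` and a constant function have different diagrams.
-/

/-! ### Extrema over path components -/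

section Components

variable {Z : Type*} [TopologicalSpace Z]

/-- The least value of `f` on a path component. -/
noncomputable def compMin (f : C(Z, ℝ)) (i : ZerothHomotopy Z) : ℝ := ⨅ x : pathComp i, f x

/-- The greatest value of `f` on a path component. -/
noncomputable def compMax (f : C(Z, ℝ)) (i : ZerothHomotopy Z) : ℝ := ⨆ x : pathComp i, f x

theorem pathComp_nonempty (i : ZerothHomotopy Z) : (pathComp i).Nonempty :=
  ZerothHomotopy.mk_surjective i

theorem joined_iff_mk_eq {x y : Z} : Joined x y ↔ ZerothHomotopy.mk x = ZerothHomotopy.mk y :=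
  (Quotient.eq (r := pathSetoid Z)).symm

variable [CompactSpace Z] [LocallyPathConnectedSpace Z]

theorem isCompact_pathComp (i : ZerothHomotopy Z) : IsCompact (pathComp i) :=
  IsClosed.isCompact ((isClosed_discrete {i}).preimage ZerothHomotopy.isQuotientMap_mk.continuous)

instance (i : ZerothHomotopy Z) : CompactSpace (pathComp i) :=
  isCompact_iff_compactSpace.1 (isCompact_pathComp i)

instance (i : ZerothHomotopy Z) : Nonempty (pathComp i) := (pathComp_nonempty i).to_subtype

theorem exists_eq_compMin (f : C(Z, ℝ)) (i : ZerothHomotopy Z) :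
    ∃ x ∈ pathComp i, f x = compMin f i := by
  obtain ⟨x, hx⟩ := (isCompact_range (f.restrict (pathComp i)).continuous).sInf_mem
    (Set.range_nonempty _)
  exact ⟨x, x.2, hx⟩

theorem exists_eq_compMax (f : C(Z, ℝ)) (i : ZerothHomotopy Z) :
    ∃ x ∈ pathComp i, f x = compMax f i := by
  obtain ⟨x, hx⟩ := (isCompact_range (f.restrict (pathComp i)).continuous).sSup_mem
    (Set.range_nonempty _)
  exact ⟨x, x.2, hx⟩

theorem compMin_le (f : C(Z, ℝ)) {i : ZerothHomotopy Z} {x : Z} (hx : x ∈ pathComp i) :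
    compMin f i ≤ f x :=
  ciInf_le (isCompact_range (f.restrict (pathComp i)).continuous).bddBelow ⟨x, hx⟩

theorem le_compMax (f : C(Z, ℝ)) {i : ZerothHomotopy Z} {x : Z} (hx : x ∈ pathComp i) :
    f x ≤ compMax f i :=
  le_ciSup (isCompact_range (f.restrict (pathComp i)).continuous).bddAbove ⟨x, hx⟩

theorem compMin_le_iff {f : C(Z, ℝ)} {i : ZerothHomotopy Z} {s : ℝ} :
    compMin f i ≤ s ↔ ∃ x ∈ pathComp i, f x ≤ s := by
  refine ⟨fun h => ?_, fun ⟨x, hx, h⟩ => (compMin_le f hx).trans h⟩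
  obtain ⟨x, hx, e⟩ := exists_eq_compMin f i
  exact ⟨x, hx, e.trans_le h⟩

theorem compMax_lt_iff {f : C(Z, ℝ)} {i : ZerothHomotopy Z} {t : ℝ} :
    compMax f i < t ↔ ∀ x ∈ pathComp i, f x < t := by
  refine ⟨fun h x hx => (le_compMax f hx).trans_lt h, fun h => ?_⟩
  obtain ⟨x, hx, e⟩ := exists_eq_compMax f i
  exact e ▸ h x hx

theorem compMin_eq [PathConnectedSpace Z] {f : C(Z, ℝ)} {v : Z} (hv : ∀ x, f v ≤ f x)
    (i : ZerothHomotopy Z) :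
    compMin f i = f v := by
  obtain ⟨x, _, hx⟩ := exists_eq_compMin f i
  exact le_antisymm (compMin_le f (Subsingleton.elim _ _)) (hx ▸ hv x)

theorem compMax_eq [PathConnectedSpace Z] {f : C(Z, ℝ)} {v : Z} (hv : ∀ x, f x ≤ f v)
    (i : ZerothHomotopy Z) :
    compMax f i = f v := by
  obtain ⟨x, _, hx⟩ := exists_eq_compMax f i
  exact le_antisymm (hx ▸ hv x) (le_compMax f (Subsingleton.elim _ _))

end Components

section ReebExtrema

theorem compMin_reebFun_eq {X : Type*} [TopologicalSpace X] [CompactSpace X]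
    [LocallyPathConnectedSpace X] [PathConnectedSpace X] {f : C(X, ℝ)} {v : X}
    (hv : ∀ x, f v ≤ f x) (i : ZerothHomotopy (Reeb f)) : compMin (reebFun f) i = f v :=
  compMin_eq (f := reebFun f) (v := Quotient.mk _ v) (Quotient.ind hv) i

theorem compMax_reebFun_eq {X : Type*} [TopologicalSpace X] [CompactSpace X]
    [LocallyPathConnectedSpace X] [PathConnectedSpace X] {f : C(X, ℝ)} {v : X}
    (hv : ∀ x, f x ≤ f v) (i : ZerothHomotopy (Reeb f)) : compMax (reebFun f) i = f v :=
  compMax_eq (f := reebFun f) (v := Quotient.mk _ v) (Quotient.ind hv) i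

end ReebExtrema

/-! ### Ranks in relative homology -/

section Rank

variable (k : Type*) [Field k] {Z : Type*} [TopologicalSpace Z]

/-- The path components that meet `S` and do not meet `A`. -/
def relComponents (S A : Set Z) : Set (ZerothHomotopy Z) :=
  {i | (∃ x ∈ pathComp i, x ∈ S) ∧ ∀ x ∈ pathComp i, x ∉ A}

/-- The map `H₀(Z, A) → k^U` that counts the points of a chain in each path component, `U` being the
set of the path components that do not meet `A`. -/
noncomputable def componentMap (A : Set Z) :
    HZeroRel k A →ₗ[k] ({i : ZerothHomotopy Z | ∀ x ∈ pathComp i, x ∉ A} →₀ k) :=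
  Submodule.liftQ _
    (Finsupp.lsubtypeDomain {i : ZerothHomotopy Z | ∀ x ∈ pathComp i, x ∉ A} ∘ₗ
      Finsupp.lmapDomain k k ZerothHomotopy.mk) <| by
    refine sup_le (Submodule.span_le.2 ?_) ?_
    · rintro _ ⟨γ, rfl⟩
      have h : ZerothHomotopy.mk (γ 1) = ZerothHomotopy.mk (γ 0) :=
        joined_iff_mk_eq.1 ⟨(⟨γ, rfl, rfl⟩ : Path (γ 0) (γ 1)).symm⟩
      simp [Finsupp.mapDomain_sub, Finsupp.mapDomain_single, h]
    · rw [Finsupp.supported_eq_span_single, Submodule.span_le]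
      rintro _ ⟨x, hx, rfl⟩
      ext ⟨i, hi⟩
      have h : ZerothHomotopy.mk x ≠ i := fun h => hi x h hx
      simp [Finsupp.mapDomain_single, Finsupp.lsubtypeDomain_apply, h]

theorem componentMap_single (A : Set Z) (x : Z)
    (hx : ∀ y ∈ pathComp (ZerothHomotopy.mk x), y ∉ A) :
    componentMap k A (Submodule.Quotient.mk (Finsupp.single x 1)) =
      Finsupp.single ⟨ZerothHomotopy.mk x, hx⟩ 1 := by
  classical
  ext ⟨i, hi⟩
  simp [componentMap, Finsupp.mapDomain_single, Finsupp.lsubtypeDomain_apply]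
  simp [Finsupp.single_apply]

theorem mk_single_eq_of_joined (A : Set Z) {x y : Z}
    (h : ZerothHomotopy.mk x = ZerothHomotopy.mk y) :
    (Submodule.Quotient.mk (Finsupp.single x 1) : HZeroRel k A) =
      Submodule.Quotient.mk (Finsupp.single y 1) := by
  obtain ⟨γ⟩ := joined_iff_mk_eq.2 h.symm
  refine (Submodule.Quotient.eq _).2 (Submodule.mem_sup_left (Submodule.subset_span ⟨γ, ?_⟩))
  simp

theorem mk_single_eq_zero (A : Set Z) {x : Z} (h : x ∈ A) :
    (Submodule.Quotient.mk (Finsupp.single x 1) : HZeroRel k A) = 0 :=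
  (Submodule.Quotient.mk_eq_zero _).2
    (Submodule.mem_sup_right (Finsupp.single_mem_supported k 1 h))

theorem range_hZeroMap (S A : Set Z) :
    LinearMap.range (hZeroMap k S A) =
      Submodule.span k (Set.range fun x : S =>
        (Submodule.Quotient.mk (Finsupp.single (x : Z) 1) : HZeroRel k A)) := by
  have h : LinearMap.range (hZeroMap k S A) =
      LinearMap.range (hZeroMap k S A ∘ₗ (zeroBoundaries k S).mkQ) := by
    rw [LinearMap.range_comp, Submodule.range_mkQ, Submodule.map_top]
  rw [h, LinearMap.range_eq_map, ← (Finsupp.basisSingleOne (R := k) (ι := S)).span_eq,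
    Submodule.map_span, ← Set.range_comp]
  congr 2
  funext x
  simp [hZeroMap]

/-- The image of `H₀(S) → H₀(Z, A)` has a basis indexed by the path components that meet `S` and do
not meet `A`: points of such components are independent, a path joins any two points of the same
component, and a point whose component meets `A` vanishes. -/
theorem finrank_range_hZeroMap [Finite (ZerothHomotopy Z)] (S A : Set Z) :
    Module.finrank k (LinearMap.range (hZeroMap k S A)) = Nat.card (relComponents S A) := by
  have := Fintype.ofFinite (relComponents S A)
  have hex : ∀ i : relComponents S A, ∃ x : S, ZerothHomotopy.mk (x : Z) = i := fun i =>
    let ⟨x, hx, hS⟩ := i.2.1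
    ⟨⟨x, hS⟩, hx⟩
  choose r hr using hex
  let b : relComponents S A → HZeroRel k A := fun i =>
    Submodule.Quotient.mk (Finsupp.single (r i : Z) 1)
  have hA : ∀ i : relComponents S A, ∀ y ∈ pathComp (ZerothHomotopy.mk (r i : Z)), y ∉ A := by
    intro i y hy
    exact i.2.2 y (by rwa [hr i] at hy)
  have hb : LinearIndependent k b := by
    refine LinearIndependent.of_comp (componentMap k A) ?_
    have h : componentMap k A ∘ b =
        (fun j => Finsupp.single j (1 : k)) ∘ fun i => ⟨i.1, i.2.2⟩ := by
      funext i
      simp only [Function.comp_apply, b]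
      rw [componentMap_single k A _ (hA i)]
      simp only [hr]
    rw [h]
    refine LinearIndependent.comp (Finsupp.linearIndependent_single_one k _) _ ?_
    intro i j hij
    exact Subtype.ext (congrArg (fun z => z.1) hij)
  have hspan : LinearMap.range (hZeroMap k S A) = Submodule.span k (Set.range b) := by
    rw [range_hZeroMap]
    refine le_antisymm (Submodule.span_le.2 ?_) (Submodule.span_mono ?_)
    · rintro _ ⟨x, rfl⟩
      by_cases h : ∀ y ∈ pathComp (ZerothHomotopy.mk (x : Z)), y ∉ A
      · have hi : ZerothHomotopy.mk (x : Z) ∈ relComponents S A := ⟨⟨x, rfl, x.2⟩, h⟩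
        exact Submodule.subset_span ⟨⟨_, hi⟩, mk_single_eq_of_joined k A (hr ⟨_, hi⟩)⟩
      · push Not at h
        obtain ⟨y, hy, hyA⟩ := h
        simp only [← mk_single_eq_of_joined k A hy, mk_single_eq_zero k A hyA]
        exact Submodule.zero_mem _
    · rintro _ ⟨i, rfl⟩
      exact ⟨r i, rfl⟩
  rw [hspan, finrank_span_eq_card hb, Nat.card_eq_fintype_card]

end Rank

/-! ### The multiplicities of `Ext₀` -/

section ExtZero

variable (k : Type*) [Field k] {Z : Type*} [TopologicalSpace Z] [CompactSpace Z]
  [LocallyPathConnectedSpace Z]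

theorem extRank_eq_card (f : C(Z, ℝ)) (s t : ℝ) :
    extRank k f s t = Nat.card {i : ZerothHomotopy Z // compMin f i ≤ s ∧ compMax f i < t} := by
  rw [extRank, finrank_range_hZeroMap]
  congr! 3 with i
  simp [relComponents, compMin_le_iff, compMax_lt_iff]

/-- The classes counted in a box are the path components whose extrema lie in that box. -/
theorem extBoxCount_eq_card (f : C(Z, ℝ)) (a b : ℝ) {ε : ℝ} (hε : 0 < ε) :
    extBoxCount k f a b ε = (Nat.card {i : ZerothHomotopy Z //
      (a - ε < compMin f i ∧ compMin f i ≤ a + ε) ∧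
        b - ε ≤ compMax f i ∧ compMax f i < b + ε} : ℤ) := by
  classical
  have := Fintype.ofFinite (ZerothHomotopy Z)
  simp only [extBoxCount, extRank_eq_card, Nat.card_eq_fintype_card, Fintype.card_subtype,
    Finset.card_filter, Nat.cast_sum, ← Finset.sum_sub_distrib]
  refine Finset.sum_congr rfl fun i _ => ?_
  by_cases h₁ : compMin f i ≤ a - ε
  · have h₂ : compMin f i ≤ a + ε := by linarith
    simp [h₁, h₂, h₁.not_gt]
  by_cases h₂ : compMax f i < b - ε
  · have h₃ : compMax f i < b + ε := by linarith
    simp [h₂, h₃, h₂.not_ge]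
  simp [h₁, h₂, not_lt.1 h₂, not_le.1 h₁]

/-- `Ext₀` has one point for each path component, the pair of the extrema on it. -/
theorem extZero_eq_card (f : C(Z, ℝ)) (p : ℝ × ℝ) :
    extZero k f p = Nat.card {i : ZerothHomotopy Z // (compMin f i, compMax f i) = p} := by
  obtain ⟨a, b⟩ := p
  have hbox : ∀ ε : {ε : ℝ // 0 < ε}, (extBoxCount k f a b ε).toNat =
      Nat.card {i : ZerothHomotopy Z // (a - ε < compMin f i ∧ compMin f i ≤ a + ε) ∧
        b - ε ≤ compMax f i ∧ compMax f i < b + ε} := fun ε => by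
    rw [extBoxCount_eq_card k f a b ε.2, Int.toNat_natCast]
  -- A box that avoids the finitely many other pairs of extrema attains the infimum.
  have hev : ∀ᶠ ε : ℝ in nhdsWithin 0 (Set.Ioi 0), ∀ i : ZerothHomotopy Z,
      (compMin f i, compMax f i) ≠ (a, b) → ε < max |compMin f i - a| |compMax f i - b| := by
    refine Filter.eventually_all.2 fun i => ?_
    by_cases hi : (compMin f i, compMax f i) = (a, b)
    · exact Filter.Eventually.of_forall fun _ h => absurd hi h
    · have hpos : 0 < max |compMin f i - a| |compMax f i - b| := by
        by_contra h
        have h' := max_le_iff.1 (not_lt.1 h)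
        exact hi (Prod.ext (sub_eq_zero.1 (abs_nonpos_iff.1 h'.1))
          (sub_eq_zero.1 (abs_nonpos_iff.1 h'.2)))
      filter_upwards [Ioo_mem_nhdsGT hpos] with ε hε _
      exact hε.2
  obtain ⟨ε, hε, hε0⟩ := (hev.and self_mem_nhdsWithin).exists
  have hε0 : 0 < ε := hε0
  refine le_antisymm ((ciInf_le' _ ⟨ε, hε0⟩).trans ?_) ?_
  · rw [hbox]
    refine Nat.card_le_card_of_injective (Subtype.map id ?_)
      (Subtype.map_injective _ Function.injective_id)
    rintro i ⟨⟨h₁, h₂⟩, h₃, h₄⟩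
    by_contra hi
    refine (hε i hi).not_ge (max_le ?_ ?_) <;> rw [abs_le] <;> constructor <;>
      simp only [] at * <;> linarith
  · have : Nonempty {ε : ℝ // 0 < ε} := ⟨⟨1, one_pos⟩⟩
    refine le_ciInf fun ε => ?_
    rw [hbox]
    refine Nat.card_le_card_of_injective (Subtype.map id ?_)
      (Subtype.map_injective _ Function.injective_id)
    rintro i hi
    obtain ⟨rfl, rfl⟩ := Prod.mk.inj hi
    have := ε.2
    refine ⟨⟨?_, ?_⟩, ?_, ?_⟩ <;> simp only [id] <;> linarith

/-- The points of `Ext₀`, repeated according to multiplicity, are the path components. -/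
theorem exists_extZero_equiv (f : C(Z, ℝ)) :
    ∃ e : (Σ p : ℝ × ℝ, Fin (extZero k f p)) ≃ ZerothHomotopy Z,
      ∀ x, x.1 = (compMin f (e x), compMax f (e x)) := by
  have e : ∀ p, Fin (extZero k f p) ≃ {i : ZerothHomotopy Z // (compMin f i, compMax f i) = p} :=
    fun p => (finCongr (extZero_eq_card k f p)).trans (Finite.equivFin _).symm
  refine ⟨(Equiv.sigmaCongrRight e).trans (Equiv.sigmaFiberEquiv _), fun ⟨p, x⟩ => ?_⟩
  exact (e p x).2.symm

/-- The off-diagonal points of `Ext₀` are the path components on which the function is not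
constant. -/
theorem exists_offDiag_equiv (f : C(Z, ℝ)) :
    ∃ e : OffDiag (extZero k f) ≃ {i : ZerothHomotopy Z // compMin f i ≠ compMax f i},
      ∀ x, x.1.1 = (compMin f (e x), compMax f (e x)) := by
  obtain ⟨e, he⟩ := exists_extZero_equiv k f
  exact ⟨e.subtypeEquiv fun x => by rw [he x], fun x => he x.1⟩

end ExtZero

/-! ### Functional distortion bounds the difference of the extrema -/

section Extrema

theorem ofReal_abs_sub_le_connFunctionalDistortion_of_max {X Y : Type*} [TopologicalSpace X]
    [TopologicalSpace Y] (f : C(X, ℝ)) (g : C(Y, ℝ)) {x : X} {y : Y}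
    (hx : ∀ x', f x' ≤ f x) (hy : ∀ y', g y' ≤ g y) :
    ENNReal.ofReal |f x - g y| ≤ connFunctionalDistortion f g := by
  refine le_iInf₂ fun Φ Ψ => le_max_of_le_right ?_
  rcases le_total (g y) (f x) with h | h
  · refine le_max_of_le_left (le_iSup_of_le x (ENNReal.ofReal_le_ofReal ?_))
    have := hy (Φ x)
    rw [abs_of_nonneg (by linarith), abs_of_nonneg (by linarith)]
    linarith
  · refine le_max_of_le_right (le_iSup_of_le y (ENNReal.ofReal_le_ofReal ?_))
    have := hx (Ψ y)
    rw [abs_of_nonpos (by linarith), abs_of_nonpos (by linarith)]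
    linarith

theorem ofReal_abs_sub_le_connFunctionalDistortion_of_min {X Y : Type*} [TopologicalSpace X]
    [TopologicalSpace Y] (f : C(X, ℝ)) (g : C(Y, ℝ)) {x : X} {y : Y}
    (hx : ∀ x', f x ≤ f x') (hy : ∀ y', g y ≤ g y') :
    ENNReal.ofReal |f x - g y| ≤ connFunctionalDistortion f g := by
  refine le_iInf₂ fun Φ Ψ => le_max_of_le_right ?_
  rcases le_total (g y) (f x) with h | h
  · refine le_max_of_le_right (le_iSup_of_le y (ENNReal.ofReal_le_ofReal ?_))
    have := hx (Ψ y)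
    rw [abs_of_nonneg (by linarith), abs_of_nonneg (by linarith)]
    linarith
  · refine le_max_of_le_left (le_iSup_of_le x (ENNReal.ofReal_le_ofReal ?_))
    have := hy (Φ x)
    rw [abs_of_nonpos (by linarith), abs_of_nonpos (by linarith)]
    linarith

variable {Z W : Type*} [TopologicalSpace Z] [TopologicalSpace W]

theorem ofReal_max_le_functionalDistortion [PathConnectedSpace Z] [PathConnectedSpace W]
    (f : C(Z, ℝ)) (g : C(W, ℝ)) {v₀ v₁ : Z} {u₀ u₁ : W}
    (hv₀ : ∀ x, f v₀ ≤ f x) (hv₁ : ∀ x, f x ≤ f v₁) (hu₀ : ∀ y, g u₀ ≤ g y)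
    (hu₁ : ∀ y, g y ≤ g u₁) :
    ENNReal.ofReal (max |f v₁ - g u₁| |f v₀ - g u₀|) ≤ functionalDistortion f g := by
  refine le_iInf fun σ => le_iSup_of_le (ZerothHomotopy.mk v₀) ?_
  have hv : ∀ x : Z, x ∈ pathComp (ZerothHomotopy.mk v₀) := fun x => Subsingleton.elim _ _
  have hu : ∀ y : W, y ∈ pathComp (σ (ZerothHomotopy.mk v₀)) := fun y => Subsingleton.elim _ _
  rw [ENNReal.ofReal_max]
  exact max_le
    (ofReal_abs_sub_le_connFunctionalDistortion_of_max (f.restrict _) (g.restrict _)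
      (x := ⟨v₁, hv v₁⟩) (y := ⟨u₁, hu u₁⟩) (fun x => hv₁ x) fun y => hu₁ y)
    (ofReal_abs_sub_le_connFunctionalDistortion_of_min (f.restrict _) (g.restrict _)
      (x := ⟨v₀, hv v₀⟩) (y := ⟨u₀, hu u₀⟩) (fun x => hv₀ x) fun y => hu₀ y)

variable [CompactSpace Z] [LocallyPathConnectedSpace Z] [CompactSpace W]
  [LocallyPathConnectedSpace W]

theorem ofReal_abs_compMin_sub_le (f : C(Z, ℝ)) (g : C(W, ℝ)) (i : ZerothHomotopy Z)
    (j : ZerothHomotopy W) : ENNReal.ofReal |compMin f i - compMin g j| ≤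
      connFunctionalDistortion (f.restrict (pathComp i)) (g.restrict (pathComp j)) := by
  obtain ⟨x, hx, ex⟩ := exists_eq_compMin f i
  obtain ⟨y, hy, ey⟩ := exists_eq_compMin g j
  rw [← ex, ← ey]
  exact ofReal_abs_sub_le_connFunctionalDistortion_of_min (f.restrict _) (g.restrict _)
    (x := ⟨x, hx⟩) (y := ⟨y, hy⟩) (fun z => ex.trans_le (compMin_le f z.2))
    fun z => ey.trans_le (compMin_le g z.2)

theorem ofReal_abs_compMax_sub_le (f : C(Z, ℝ)) (g : C(W, ℝ)) (i : ZerothHomotopy Z)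
    (j : ZerothHomotopy W) : ENNReal.ofReal |compMax f i - compMax g j| ≤
      connFunctionalDistortion (f.restrict (pathComp i)) (g.restrict (pathComp j)) := by
  obtain ⟨x, hx, ex⟩ := exists_eq_compMax f i
  obtain ⟨y, hy, ey⟩ := exists_eq_compMax g j
  rw [← ex, ← ey]
  exact ofReal_abs_sub_le_connFunctionalDistortion_of_max (f.restrict _) (g.restrict _)
    (x := ⟨x, hx⟩) (y := ⟨y, hy⟩) (fun z => (le_compMax f z.2).trans_eq ex.symm)
    fun z => (le_compMax g z.2).trans_eq ey.symm

end Extrema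

/-! ### Comparison of the two distances -/

section Comparison

variable (k : Type*) [Field k] {Z W : Type*} [TopologicalSpace Z] [TopologicalSpace W]
  [CompactSpace Z] [LocallyPathConnectedSpace Z] [CompactSpace W] [LocallyPathConnectedSpace W]

/-- A bijection of the path components is a matching of the diagrams, at a cost bounded by the
differences of the extrema on matched components. -/
theorem bottleneckDist_extZero_le (f : C(Z, ℝ)) (g : C(W, ℝ))
    (σ : ZerothHomotopy Z ≃ ZerothHomotopy W) {B : ℝ≥0∞}
    (hmin : ∀ i, ENNReal.ofReal |compMin f i - compMin g (σ i)| ≤ B)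
    (hmax : ∀ i, ENNReal.ofReal |compMax f i - compMax g (σ i)| ≤ B) :
    bottleneckDist (extZero k f) (extZero k g) ≤ B := by
  obtain ⟨e₁, he₁⟩ := exists_offDiag_equiv k f
  obtain ⟨e₂, he₂⟩ := exists_offDiag_equiv k g
  -- A point is matched when its component corresponds to one whose point is off the diagonal.
  let S : Set (OffDiag (extZero k f)) := {x | compMin g (σ (e₁ x)) ≠ compMax g (σ (e₁ x))}
  let T : Set (OffDiag (extZero k g)) :=
    {y | compMin f (σ.symm (e₂ y)) ≠ compMax f (σ.symm (e₂ y))}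
  let M : S ≃ T :=
    { toFun := fun x => ⟨e₂.symm ⟨σ (e₁ x), x.2⟩, by simpa [T] using (e₁ x).2⟩
      invFun := fun y => ⟨e₁.symm ⟨σ.symm (e₂ y), y.2⟩, by simpa [S] using (e₂ y).2⟩
      left_inv := fun x => by simp
      right_inv := fun y => by simp }
  have hM : ∀ x : S, (e₂ (M x) : ZerothHomotopy W) = σ (e₁ x) := fun x => by simp [M]
  -- If one of the intervals is degenerate, the other has half-length at most the larger
  -- displacement of the ends.
  have hhalf : ∀ i, compMin f i = compMax f i ∨ compMin g (σ i) = compMax g (σ i) →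
      ENNReal.ofReal (1 / 2 * |compMin f i - compMax f i|) ≤ B ∧
        ENNReal.ofReal (1 / 2 * |compMin g (σ i) - compMax g (σ i)|) ≤ B := fun i h => by
    have hB := max_le (hmin i) (hmax i)
    rw [← ENNReal.ofReal_max] at hB
    set m := max |compMin f i - compMin g (σ i)| |compMax f i - compMax g (σ i)|
    have h₁ := abs_le.1 (le_max_left _ _ : |compMin f i - compMin g (σ i)| ≤ m)
    have h₂ := abs_le.1 (le_max_right _ _ : |compMax f i - compMax g (σ i)| ≤ m)
    have h₃ : |compMin f i - compMax f i| ≤ 2 * m ∧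
        |compMin g (σ i) - compMax g (σ i)| ≤ 2 * m := by
      rw [abs_le, abs_le]
      rcases h with h | h <;> refine ⟨⟨?_, ?_⟩, ?_, ?_⟩ <;> linarith
    exact ⟨(ENNReal.ofReal_le_ofReal (by linarith)).trans hB,
      (ENNReal.ofReal_le_ofReal (by linarith)).trans hB⟩
  refine iInf_le_of_le S (iInf_le_of_le T (iInf_le_of_le M (max_le (iSup_le fun x => ?_)
    (max_le (iSup₂_le fun x hx => ?_) (iSup₂_le fun y hy => ?_)))))
  · rw [he₁, he₂, hM, Prod.dist_eq, ENNReal.ofReal_max, Real.dist_eq, Real.dist_eq]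
    exact max_le (hmin _) (hmax _)
  · rw [diagCost, he₁]
    exact (hhalf _ (Or.inr (not_not.1 hx))).1
  · rw [diagCost, he₂]
    simpa using (hhalf (σ.symm (e₂ y)) (Or.inl (not_not.1 hy))).2

theorem bottleneckDist_extZero_le_functionalDistortion (f : C(Z, ℝ)) (g : C(W, ℝ)) :
    bottleneckDist (extZero k f) (extZero k g) ≤ functionalDistortion f g :=
  le_iInf fun σ => bottleneckDist_extZero_le k f g σ
    (fun i => (ofReal_abs_compMin_sub_le f g i (σ i)).trans
      (le_iSup (fun i => connFunctionalDistortion (f.restrict (pathComp i))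
        (g.restrict (pathComp (σ i)))) i))
    fun i => (ofReal_abs_compMax_sub_le f g i (σ i)).trans
      (le_iSup (fun i => connFunctionalDistortion (f.restrict (pathComp i))
        (g.restrict (pathComp (σ i)))) i)

end Comparison

/-! ### Topology of constructible fields -/

section Constructible

variable {X : Type u} [TopologicalSpace X] {f : C(X, ℝ)}

theorem IsConstructible.compactSpace (hf : IsConstructible f) : CompactSpace X :=
  let ⟨_, h, _⟩ := hf
  h.symm.compactSpace

theorem IsConstructible.locallyPathConnectedSpace (hf : IsConstructible f) :
    LocallyPathConnectedSpace X := by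
  obtain ⟨D, h, _⟩ := hf
  have (i : Fin D.n) : LocallyPathConnectedSpace (Set.Icc (D.a i.castSucc) (D.a i.succ)) :=
    (convex_Icc _ _).locallyPathConnectedSpace
  exact h.isOpenEmbedding.locallyPathConnectedSpace

end Constructible

/-! ### Criteria for constructibility -/

section Criteria

variable {X : Type u} [TopologicalSpace X]

theorem isConstructible_const [CompactSpace X] [LocallyPathConnectedSpace X] (r : ℝ) :
    IsConstructible (ContinuousMap.const X r) := by
  let D : ConstructibleData.{u} :=
    { n := 0
      a := fun _ => r
      strictMono_a := fun i j h => absurd h (Subsingleton.elim (α := Fin 1) i j).not_lt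
      V := fun _ => X
      E := fun _ => PEmpty
      lower := fun i => i.elim0
      upper := fun i => i.elim0 }
  let h : X ≃ₜ D.Space :=
    { toFun := fun x => Quot.mk _ (Sum.inl ⟨(0 : Fin 1), x⟩)
      invFun := Quot.lift (Sum.elim (fun v => v.2) fun e => e.1.elim0) fun _ _ hg => by
        rcases hg with ⟨i, _⟩ | ⟨i, _⟩ <;> exact i.elim0
      left_inv := fun x => rfl
      right_inv := by
        rintro ⟨⟨i, x⟩ | ⟨i, _⟩⟩
        · obtain rfl : i = (0 : Fin 1) := Subsingleton.elim (α := Fin 1) _ _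
          rfl
        · exact i.elim0
      continuous_toFun := continuous_quot_mk.comp (continuous_inl.comp continuous_sigmaMk)
      continuous_invFun := by
        refine continuous_quot_lift _ (continuous_sum_dom.2 ⟨?_, ?_⟩)
        · exact continuous_sigma fun _ => continuous_id
        · exact continuous_sigma fun i => i.elim0 }
  exact ⟨D, h, fun _ => rfl⟩

/-- A function on a compact Hausdorff space with values in `[0, 1]` is constructible if a cylinder
`E × [0, 1]` maps onto the space over `[0, 1]`, injectively on the open part of the cylinder. -/
theorem isConstructible_of_cylinder [CompactSpace X] [T2Space X] (f : C(X, ℝ)) {E : Type u}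
    [TopologicalSpace E] [CompactSpace E] [LocallyPathConnectedSpace E]
    (hfib : ∀ r : ℝ, LocallyPathConnectedSpace (f ⁻¹' {r}))
    (q : C(E × unitInterval, X)) (hf : ∀ e t, f (q (e, t)) = t) (hq : Function.Surjective q)
    (hinj : ∀ e e' t, 0 < t → t < 1 → q (e, t) = q (e', t) → e = e') : IsConstructible f := by
  have hcpt : ∀ r : ℝ, CompactSpace (f ⁻¹' {r}) := fun r =>
    isCompact_iff_compactSpace.1 (isClosed_singleton.preimage f.continuous).isCompact
  have hlow : ∀ i : Fin 1, ((i.castSucc : Fin 2) : ℝ) = 0 := fun i => by simp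
  have hupp : ∀ i : Fin 1, ((i.succ : Fin 2) : ℝ) = 1 := fun i => by simp
  let D : ConstructibleData.{u} :=
    { n := 1
      a := fun i => ((i : Fin 2) : ℝ)
      strictMono_a := fun i j h => by simpa using h
      V := fun i => f ⁻¹' {((i : Fin 2) : ℝ)}
      E := fun _ => E
      lower := fun i => ⟨fun e => ⟨q (e, 0), by simp [hf]⟩, by fun_prop⟩
      upper := fun i => ⟨fun e => ⟨q (e, 1), by simp [hf]⟩, by fun_prop⟩ }
  have hIcc : ∀ (i : Fin D.n) (t : Set.Icc (D.a i.castSucc) (D.a i.succ)),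
      (t : ℝ) ∈ unitInterval := fun i t => ⟨(hlow i).symm.trans_le t.2.1, t.2.2.trans_eq (hupp i)⟩
  let F : D.Pieces → X :=
    Sum.elim (fun v => v.2) fun e => q (e.2.1, ⟨e.2.2, hIcc e.1 e.2.2⟩)
  have hF : Continuous F := by
    refine continuous_sum_dom.2 ⟨continuous_sigma fun _ => continuous_subtype_val, ?_⟩
    refine continuous_sigma fun i => ?_
    change Continuous fun e : E × Set.Icc (D.a i.castSucc) (D.a i.succ) =>
      q (e.1, ⟨e.2, hIcc i e.2⟩)
    fun_prop
  have hheight : ∀ p, f (F p) = D.pieceHeight p := by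
    rintro (⟨i, x⟩ | ⟨i, e, t⟩)
    · exact x.2
    · exact hf _ _
  have hglue : ∀ p p', D.Glue p p' → F p = F p' := by
    rintro _ _ (⟨i, e, t, ht⟩ | ⟨i, e, t, ht⟩)
    · exact congrArg (fun s => q (e, s)) (Subtype.ext (ht.trans (hlow i)))
    · exact congrArg (fun s => q (e, s)) (Subtype.ext (ht.trans (hupp i)))
  let G : D.Space → X := Quot.lift F hglue
  -- Over the end values, every point is glued to a point of a critical fiber.
  have hend : ∀ p : D.Pieces, (∃ (i : Fin 2) (hi : f (F p) = (i : ℝ)),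
      Quot.mk D.Glue p = Quot.mk D.Glue (Sum.inl ⟨i, ⟨F p, hi⟩⟩)) ∨
        ∃ (e : E) (t : Set.Icc (D.a (0 : Fin 1).castSucc) (D.a (0 : Fin 1).succ)),
          p = Sum.inr ⟨(0 : Fin 1), e, t⟩ ∧ (t : ℝ) ≠ 0 ∧ (t : ℝ) ≠ 1 := by
    rintro (⟨i, x⟩ | ⟨i, e, t⟩)
    · exact Or.inl ⟨i, x.2, rfl⟩
    · obtain rfl : i = (0 : Fin 1) := Subsingleton.elim (α := Fin 1) _ _
      by_cases h0 : (t : ℝ) = 0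
      · refine Or.inl ⟨0, by rw [hheight]; simpa [ConstructibleData.pieceHeight] using h0, ?_⟩
        refine (Quot.sound (.lower (D := D) (0 : Fin 1) e t (h0.trans (hlow 0).symm))).trans ?_
        congr 3
        exact Subtype.ext
          (hglue _ _ (.lower (D := D) (0 : Fin 1) e t (h0.trans (hlow 0).symm))).symm
      by_cases h1 : (t : ℝ) = 1
      · refine Or.inl ⟨1, by rw [hheight]; simpa [ConstructibleData.pieceHeight] using h1, ?_⟩
        refine (Quot.sound (.upper (D := D) (0 : Fin 1) e t (h1.trans (hupp 0).symm))).trans ?_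
        congr 3
        exact Subtype.ext
          (hglue _ _ (.upper (D := D) (0 : Fin 1) e t (h1.trans (hupp 0).symm))).symm
      exact Or.inr ⟨e, t, rfl, h0, h1⟩
  have hGinj : Function.Injective G := by
    rintro ⟨p⟩ ⟨p'⟩ (h : F p = F p')
    have key : ∀ p p', F p = F p' → ∀ (i : Fin 2) (hi : f (F p) = (i : ℝ)),
        Quot.mk D.Glue p = Quot.mk D.Glue (Sum.inl ⟨i, ⟨F p, hi⟩⟩) →
          Quot.mk D.Glue p = Quot.mk D.Glue p' := by
      intro p p' h i hi hp
      rcases hend p' with ⟨j, hj, hp'⟩ | ⟨e, t, rfl, h0, h1⟩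
      · obtain rfl : i = j := by
          have : ((i : Fin 2) : ℝ) = j := by rw [← hi, ← hj, h]
          exact Fin.ext (by exact_mod_cast this)
        rw [hp, hp']
        congr 3
        exact Subtype.ext h
      · have ht : (t : ℝ) = i := by rw [← hi, h, hheight]; rfl
        fin_cases i
        · exact absurd (by simpa using ht) h0
        · exact absurd (by simpa using ht) h1
    rcases hend p with ⟨i, hi, hp⟩ | ⟨e, t, rfl, h0, h1⟩
    · exact key p p' h i hi hp
    rcases hend p' with ⟨i, hi, hp'⟩ | ⟨e', t', rfl, h0', h1'⟩
    · exact (key p' _ h.symm i hi hp').symm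
    have htt : t = t' := by
      have := congrArg f h
      rw [hheight, hheight] at this
      exact Subtype.ext this
    subst htt
    have ht := hIcc 0 t
    obtain rfl := hinj e e' ⟨t, ht⟩ (lt_of_le_of_ne ht.1 fun h => h0 (congrArg Subtype.val h.symm))
      (lt_of_le_of_ne ht.2 fun h => h1 (congrArg Subtype.val h)) h
    rfl
  have hGsurj : Function.Surjective G := fun x => by
    obtain ⟨⟨e, t⟩, rfl⟩ := hq x
    exact ⟨Quot.mk _ (Sum.inr ⟨(0 : Fin 1), e, ⟨t, (hlow 0).trans_le t.2.1,
      t.2.2.trans_eq (hupp 0).symm⟩⟩), rfl⟩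
  let h : D.Space ≃ₜ X := Continuous.homeoOfEquivCompactToT2
    (f := Equiv.ofBijective G ⟨hGinj, hGsurj⟩) (continuous_quot_lift _ hF)
  refine ⟨D, h.symm, fun x => ?_⟩
  obtain ⟨⟨p⟩, rfl⟩ := h.surjective x
  rw [h.symm_apply_apply]
  exact (hheight p).symm

end Criteria

/-! ### Height distances and functional distortion -/

section HeightDist

theorem bddAbove_range_comp_path {X : Type*} [TopologicalSpace X] (f : C(X, ℝ)) {u v : X}
    (γ : Path u v) : BddAbove (Set.range fun t => f (γ t)) :=
  (isCompact_range (f.continuous.comp γ.continuous)).bddAbove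

theorem bddBelow_range_comp_path {X : Type*} [TopologicalSpace X] (f : C(X, ℝ)) {u v : X}
    (γ : Path u v) : BddBelow (Set.range fun t => f (γ t)) :=
  (isCompact_range (f.continuous.comp γ.continuous)).bddBelow

theorem sub_le_pathHeight {X : Type*} [TopologicalSpace X] (f : C(X, ℝ)) {u v : X} (γ : Path u v)
    (s t : unitInterval) : f (γ s) - f (γ t) ≤ pathHeight f γ :=
  sub_le_sub (le_ciSup (bddAbove_range_comp_path f γ) s) (ciInf_le (bddBelow_range_comp_path f γ) t)

theorem heightDist_le_pathHeight {X : Type*} [TopologicalSpace X] (f : C(X, ℝ)) {u v : X}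
    (γ : Path u v) : heightDist f u v ≤ pathHeight f γ :=
  ciInf_le ⟨0, by rintro _ ⟨γ, rfl⟩; simpa using sub_le_pathHeight f γ 0 0⟩ γ

/-- Two points of `Y` on the same level are sent by `Ψ` to points of `X` whose values differ by at
most `2 ε`, where `ε` bounds the displacement. If distances in `X` are bounded by differences of
values, these points are within `2 ε`, and distortion at most `ε` leaves the original points within
`4 ε`. -/
theorem ofReal_heightDist_le_connFunctionalDistortion {X Y : Type*} [TopologicalSpace X]
    [TopologicalSpace Y] (f : C(X, ℝ)) (g : C(Y, ℝ))
    (hf : ∀ u v, heightDist f u v ≤ |f u - f v|) {y y' : Y} (hy : g y = g y') :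
    ENNReal.ofReal (heightDist g y y' / 4) ≤ connFunctionalDistortion f g := by
  refine le_iInf₂ fun Φ Ψ => ?_
  set B := max (mapDistortion f g Φ Ψ)
      (max (⨆ x, ENNReal.ofReal |f x - g (Φ x)|) (⨆ y, ENNReal.ofReal |f (Ψ y) - g y|))
  rcases eq_or_ne B ⊤ with h | h
  · rw [h]
    exact le_top
  have hval : ∀ z, |f (Ψ z) - g z| ≤ B.toReal := fun z =>
    (ENNReal.ofReal_le_iff_le_toReal h).1 <|
      (le_iSup (fun z => ENNReal.ofReal |f (Ψ z) - g z|) z).trans ((le_max_right _ _).trans (le_max_right _ _))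
  have hdist : pointDistortion f g (Ψ y, y) (Ψ y', y') ≤ B.toReal := by
    refine (ENNReal.ofReal_le_iff_le_toReal h).1 (le_trans ?_ (le_max_left _ _))
    have hmem : ∀ z, (Ψ z, z) ∈ supergraph Φ Ψ := fun z => Or.inr rfl
    exact (le_iSup₂_of_le (Ψ y, y) (hmem y) (le_iSup₂_of_le (Ψ y', y') (hmem y') le_rfl))
  rw [pointDistortion] at hdist
  refine (ENNReal.ofReal_le_iff_le_toReal h).2 ?_
  have h₁ := abs_le.1 (hval y)
  have h₂ := abs_le.1 (hval y')
  have h₃ := neg_abs_le (heightDist f (Ψ y) (Ψ y') - heightDist g y y')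
  have h₄ : |f (Ψ y) - f (Ψ y')| ≤ 2 * B.toReal := abs_le.2 ⟨by linarith, by linarith⟩
  have h₅ := hf (Ψ y) (Ψ y')
  linarith

end HeightDist

/-! ### Two functions on an interval with the same extrema -/

section Interval

/-- The unit interval, in an arbitrary universe. -/
abbrev LiftedInterval : Type u := ULift.{u} unitInterval

/-- The coordinate of the interval. -/
def coordFun : C(LiftedInterval.{u}, ℝ) := ⟨fun x => (x.down : ℝ), by fun_prop⟩

/-- The coordinate of the interval, rescaled to run from `-1` to `1`. -/
def signedFun : C(LiftedInterval.{u}, ℝ) := ⟨fun x => 2 * (x.down : ℝ) - 1, by fun_prop⟩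

/-- The V-shaped function `t ↦ |2 t - 1|`. -/
def veeFun : C(LiftedInterval.{u}, ℝ) := ⟨fun x => |signedFun x|, by fun_prop⟩

instance : LocallyPathConnectedSpace unitInterval := (convex_Icc 0 1).locallyPathConnectedSpace

instance : LocallyPathConnectedSpace LiftedInterval.{u} :=
  Homeomorph.ulift.isOpenEmbedding.locallyPathConnectedSpace

instance : PathConnectedSpace unitInterval :=
  isPathConnected_iff_pathConnectedSpace.1 ((convex_Icc 0 1).isPathConnected ⟨0, by simp⟩)

instance : PathConnectedSpace LiftedInterval.{u} :=
  Homeomorph.ulift.symm.surjective.pathConnectedSpace Homeomorph.ulift.symm.continuous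

theorem coordFun_injective : Function.Injective coordFun.{u} :=
  Subtype.val_injective.comp ULift.down_injective

theorem signedFun_injective : Function.Injective signedFun.{u} := fun x y h =>
  coordFun_injective (by simpa [signedFun, coordFun] using h)

theorem locallyPathConnectedSpace_of_finite {X : Type*} [TopologicalSpace X] [T1Space X] {s : Set X}
    (hs : s.Finite) : LocallyPathConnectedSpace s := by
  have := hs.to_subtype
  have : DiscreteTopology s := inferInstance
  infer_instance

theorem isConstructible_coordFun : IsConstructible coordFun.{u} :=
  isConstructible_of_cylinder coordFun (E := PUnit)
    (fun r => locallyPathConnectedSpace_of_finite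
      ((Set.finite_singleton r).preimage coordFun_injective.injOn))
    ⟨fun p => ⟨p.2⟩, by fun_prop⟩ (fun _ _ => rfl) (fun x => ⟨(.unit, x.down), rfl⟩)
    fun _ _ _ _ _ _ => rfl

/-- The sign attached to each branch of the V-shaped function. -/
noncomputable def branchSign (e : ULift.{u} Bool) : ℝ := if e.down then 1 else -1

theorem branchSign_eq (e : ULift.{u} Bool) : branchSign e = 1 ∨ branchSign e = -1 := by
  unfold branchSign
  split_ifs <;> simp

/-- The cylinder over two points, mapped to the interval so that `|2 t - 1|` becomes the height. -/
noncomputable def veeCylinder : C(ULift.{u} Bool × unitInterval, LiftedInterval.{u}) where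
  toFun p := ⟨⟨(1 + branchSign p.1 * p.2) / 2, by
    have h₁ := p.2.2.1
    have h₂ := p.2.2.2
    rcases branchSign_eq p.1 with h | h <;> rw [h] <;> constructor <;> linarith⟩⟩
  continuous_toFun := by
    have : Continuous branchSign.{u} := continuous_of_discreteTopology
    fun_prop

theorem signedFun_veeCylinder (e : ULift.{u} Bool) (t : unitInterval) :
    signedFun (veeCylinder (e, t)) = branchSign e * t := by
  simp only [signedFun, veeCylinder, ContinuousMap.coe_mk]
  ring

theorem isConstructible_veeFun : IsConstructible veeFun.{u} := by
  refine isConstructible_of_cylinder veeFun (fun r => locallyPathConnectedSpace_of_finite ?_)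
    veeCylinder (fun e t => ?_) (fun x => ?_) fun e e' t ht _ h => ?_
  · refine ((Set.toFinite {r, -r}).preimage signedFun_injective.injOn).subset fun x hx => ?_
    exact eq_or_eq_neg_of_abs_eq hx
  · have := t.2.1
    change |signedFun _| = _
    rw [signedFun_veeCylinder]
    rcases branchSign_eq e with h | h <;> simp [h, abs_of_nonneg this]
  · have h : |signedFun x| ≤ 1 := by
      have h₁ := x.down.2.1
      have h₂ := x.down.2.2
      exact abs_le.2 ⟨by simp only [signedFun, ContinuousMap.coe_mk]; linarith,
        by simp only [signedFun, ContinuousMap.coe_mk]; linarith⟩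
    refine ⟨(⟨decide (0 ≤ signedFun x)⟩, ⟨|signedFun x|, abs_nonneg _, h⟩),
      signedFun_injective ?_⟩
    rw [signedFun_veeCylinder]
    rcases le_or_gt 0 (signedFun x) with h0 | h0
    · simp [branchSign, h0, abs_of_nonneg]
    · simp [branchSign, h0.not_ge, abs_of_neg h0]
  · have h' := congrArg signedFun h
    rw [signedFun_veeCylinder, signedFun_veeCylinder] at h'
    have ht' : (t : ℝ) ≠ 0 := fun h => ht.ne' (Subtype.ext h)
    have h'' := mul_right_cancel₀ ht' h'
    obtain ⟨_ | _⟩ := e <;> obtain ⟨_ | _⟩ := e' <;> simp [branchSign] at h'' ⊢ <;> norm_num at h''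

/-- The segment between two points of the interval. -/
def segmentPath (x y : LiftedInterval.{u}) : Path x y where
  toFun t := ⟨⟨(1 - t) * x.down + t * y.down,
    (convex_Icc (0 : ℝ) 1) x.down.2 y.down.2 (by linarith [t.2.2]) t.2.1 (by ring)⟩⟩
  continuous_toFun := by fun_prop
  source' := by simp
  target' := by simp

theorem pathHeight_segmentPath_le (x y : LiftedInterval.{u}) :
    pathHeight coordFun (segmentPath x y) ≤ |coordFun x - coordFun y| := by
  have h : ∀ t, coordFun (segmentPath x y t) ∈ Set.uIcc (coordFun x) (coordFun y) := fun t =>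
    (convex_uIcc (coordFun x) (coordFun y)) Set.left_mem_uIcc Set.right_mem_uIcc
      (by linarith [t.2.2]) t.2.1 (by ring : (1 - (t : ℝ)) + t = 1)
  rw [← max_sub_min_eq_abs']
  exact sub_le_sub (ciSup_le fun t => (h t).2) (le_ciInf fun t => (h t).1)

/-- The signed coordinate is constant on the components of the level sets of its absolute value, as
a connected set of points at the same distance from the middle lies on one side of it. -/
theorem signedFun_eq_of_reebSetoid {x y : LiftedInterval.{u}} (h : reebSetoid veeFun x y) :
    signedFun x = signedFun y := by
  obtain ⟨hxy, hy⟩ := h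
  rcases abs_eq_abs.1 hxy with h | h
  · exact h
  have hx : x ∈ connectedComponentIn (veeFun ⁻¹' {veeFun x}) x := mem_connectedComponentIn rfl
  have hc := (isPreconnected_connectedComponentIn.image signedFun
    signedFun.continuous.continuousOn).ordConnected.uIcc_subset
      (Set.mem_image_of_mem _ hx) (Set.mem_image_of_mem _ hy)
  obtain ⟨z, hz, hz0⟩ := hc (show (0 : ℝ) ∈ _ by
    rw [Set.mem_uIcc, h]
    rcases le_total 0 (signedFun y) with h | h
    · exact Or.inl ⟨by linarith, h⟩
    · exact Or.inr ⟨h, by linarith⟩)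
  have hz' : |signedFun z| = |signedFun x| :=
    connectedComponentIn_subset (veeFun ⁻¹' {veeFun x}) x hz
  rw [hz0, abs_zero] at hz'
  have := abs_eq_zero.1 hz'.symm
  linarith

/-- The signed coordinate, on the Reeb graph of its absolute value. -/
def reebSignedFun : C(Reeb veeFun.{u}, ℝ) where
  toFun := Quotient.lift signedFun fun _ _ h => signedFun_eq_of_reebSetoid h
  continuous_toFun := signedFun.continuous.quotient_lift _

theorem reebFun_veeFun (z : Reeb veeFun.{u}) : reebFun veeFun z = |reebSignedFun z| := by
  obtain ⟨x, rfl⟩ := Quotient.exists_rep z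
  rfl

/-- Any path between the two ends of the V passes through its bottom. -/
theorem one_le_heightDist_veeFun (i : ZerothHomotopy (Reeb veeFun.{u})) {y y' : pathComp i}
    (hy : reebSignedFun y.1 = -1) (hy' : reebSignedFun y'.1 = 1) :
    1 ≤ heightDist ((reebFun veeFun).restrict (pathComp i)) y y' := by
  have : PathConnectedSpace (pathComp i) := by
    have h : ∀ z : Reeb veeFun.{u}, z ∈ pathComp i := fun z => Subsingleton.elim _ _
    exact Function.Surjective.pathConnectedSpace (f := fun z => (⟨z, h z⟩ : pathComp i))
      (fun z => ⟨z.1, rfl⟩) (by fun_prop)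
  have : Nonempty (Path y y') := PathConnectedSpace.joined y y'
  refine le_ciInf fun γ => ?_
  have hγ : Continuous fun t => reebSignedFun (γ t).1 := by fun_prop
  obtain ⟨t, ht⟩ := mem_range_of_exists_le_of_exists_ge hγ (c := (0 : ℝ))
    ⟨0, by simp [hy]⟩ ⟨1, by simp [hy']⟩
  refine le_trans ?_ (sub_le_pathHeight _ γ 1 t)
  simp [reebFun_veeFun, hy', ht]

theorem heightDist_coordFun_le (i : ZerothHomotopy (Reeb coordFun.{u})) (u v : pathComp i) :
    heightDist ((reebFun coordFun).restrict (pathComp i)) u v ≤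
      |(reebFun coordFun).restrict (pathComp i) u -
        (reebFun coordFun).restrict (pathComp i) v| := by
  have h : ∀ z : Reeb coordFun.{u}, z ∈ pathComp i := fun z => Subsingleton.elim _ _
  let s : LiftedInterval.{u} → pathComp i := fun x => ⟨Quotient.mk _ x, h _⟩
  have hs : Continuous s := continuous_quotient_mk'.subtype_mk _
  have hsurj : Function.Surjective s := fun ⟨z, hz⟩ => by
    obtain ⟨x, rfl⟩ := Quotient.exists_rep z
    exact ⟨x, rfl⟩
  obtain ⟨x, rfl⟩ := hsurj u
  obtain ⟨y, rfl⟩ := hsurj v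
  exact (heightDist_le_pathHeight _ ((segmentPath x y).map hs)).trans
    (pathHeight_segmentPath_le x y)

theorem functionalDistortion_coordFun_veeFun_ne_zero :
    reebFunctionalDistortion coordFun.{u} veeFun.{u} ≠ 0 := by
  have hpos : (0 : ℝ≥0∞) < ENNReal.ofReal (1 / 4) := ENNReal.ofReal_pos.2 (by norm_num)
  refine (hpos.trans_le (le_iInf fun σ => ?_)).ne'
  refine le_iSup_of_le (ZerothHomotopy.mk (Quotient.mk _ ⟨0⟩)) ?_
  have h : ∀ z : Reeb veeFun.{u}, z ∈ pathComp (σ (ZerothHomotopy.mk (Quotient.mk _ ⟨0⟩))) :=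
    fun z => Subsingleton.elim _ _
  refine le_trans (ENNReal.ofReal_le_ofReal (div_le_div_of_nonneg_right ?_ (by norm_num)))
    (ofReal_heightDist_le_connFunctionalDistortion _ _ (heightDist_coordFun_le _)
      (y := ⟨Quotient.mk _ ⟨0⟩, h _⟩) (y' := ⟨Quotient.mk _ ⟨1⟩, h _⟩) ?_)
  · refine one_le_heightDist_veeFun _ ?_ ?_
    · change 2 * (0 : ℝ) - 1 = -1
      norm_num
    · change 2 * (1 : ℝ) - 1 = 1
      norm_num
  · change |2 * (0 : ℝ) - 1| = |2 * (1 : ℝ) - 1|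
    norm_num

theorem coordFun_zero_le (x : LiftedInterval.{u}) : coordFun ⟨0⟩ ≤ coordFun x := x.down.2.1

theorem coordFun_le_one (x : LiftedInterval.{u}) : coordFun x ≤ coordFun ⟨1⟩ := x.down.2.2

theorem veeFun_middle : veeFun.{u} ⟨⟨1 / 2, by norm_num, by norm_num⟩⟩ = 0 := by
  change |2 * (1 / 2 : ℝ) - 1| = 0
  norm_num

theorem veeFun_one : veeFun.{u} ⟨1⟩ = 1 := by
  change |2 * (1 : ℝ) - 1| = 1
  norm_num

theorem veeFun_le_one (x : LiftedInterval.{u}) : veeFun x ≤ 1 := by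
  have h₁ := x.down.2.1
  have h₂ := x.down.2.2
  exact abs_le.2 ⟨by simp only [signedFun, ContinuousMap.coe_mk]; linarith,
    by simp only [signedFun, ContinuousMap.coe_mk]; linarith⟩

variable (k : Type*) [Field k]

theorem bottleneckDist_coordFun_veeFun : reebBottleneckExtZero k coordFun.{u} veeFun.{u} = 0 := by
  have hmin (j) : compMin (reebFun veeFun.{u}) j = 0 :=
    (compMin_reebFun_eq (fun x => veeFun_middle.trans_le (abs_nonneg _)) j).trans veeFun_middle.{u}
  have hmax (j) : compMax (reebFun veeFun.{u}) j = 1 :=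
    (compMax_reebFun_eq (fun x => (veeFun_le_one x).trans_eq veeFun_one.symm) j).trans
      veeFun_one.{u}
  let σ : ZerothHomotopy (Reeb coordFun.{u}) ≃ ZerothHomotopy (Reeb veeFun.{u}) :=
    equivOfSubsingletonOfSubsingleton (fun _ => Classical.arbitrary _)
      fun _ => Classical.arbitrary _
  refine le_antisymm (bottleneckDist_extZero_le k _ _ σ (fun i => ?_) fun i => ?_) zero_le
  · rw [compMin_reebFun_eq coordFun_zero_le, hmin]
    simp [coordFun]
  · rw [compMax_reebFun_eq coordFun_le_one, hmax]
    simp [coordFun]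

theorem bottleneckDist_coordFun_const_ne_zero :
    reebBottleneckExtZero k coordFun.{u} (ContinuousMap.const LiftedInterval.{u} 0) ≠ 0 := by
  obtain ⟨e₁, he₁⟩ := exists_offDiag_equiv k (reebFun coordFun.{u})
  obtain ⟨e₂, he₂⟩ := exists_offDiag_equiv k (reebFun (ContinuousMap.const LiftedInterval.{u} 0))
  have hmin (i) : compMin (reebFun coordFun.{u}) i = 0 := compMin_reebFun_eq coordFun_zero_le i
  have hmax (i) : compMax (reebFun coordFun.{u}) i = 1 := compMax_reebFun_eq coordFun_le_one i
  have hempty : IsEmpty (OffDiag (extZero k (reebFun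
      (ContinuousMap.const LiftedInterval.{u} 0)))) := ⟨fun y => (e₂ y).2 <|
    (compMin_reebFun_eq (v := (⟨0⟩ : LiftedInterval)) (fun _ => le_rfl) _).trans
      (compMax_reebFun_eq (v := (⟨0⟩ : LiftedInterval)) (fun _ => le_rfl) _).symm⟩
  let x := e₁.symm ⟨ZerothHomotopy.mk (Quotient.mk _ ⟨0⟩), by rw [hmin, hmax]; norm_num⟩
  have hpos : (0 : ℝ≥0∞) < ENNReal.ofReal (diagCost x) := by
    rw [diagCost, he₁, hmin, hmax]
    exact ENNReal.ofReal_pos.2 (by norm_num)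
  refine (hpos.trans_le (le_iInf fun S => le_iInf₂ fun T M => ?_)).ne'
  have hx : x ∈ Sᶜ := fun hx => hempty.elim (M ⟨x, hx⟩).1
  exact le_max_of_le_right (le_max_of_le_left
    (le_iSup₂ (f := fun x (_ : x ∈ Sᶜ) => ENNReal.ofReal (diagCost x)) x hx))

end Interval

/-! ### The two distances on Reeb graphs -/

theorem mainTheorem4 (k : Type*) [Field k] :
    (∀ (X : Type u) (Y : Type v) [TopologicalSpace X] [TopologicalSpace Y]
      (f : C(X, ℝ)) (g : C(Y, ℝ)), IsConstructible f → IsConstructible g →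
        reebBottleneckExtZero k f g ≤ reebFunctionalDistortion f g) ∧
    (∀ (X : Type u) (Y : Type v) [TopologicalSpace X] [TopologicalSpace Y]
      (f : C(X, ℝ)) (g : C(Y, ℝ)), IsConstructible f → IsConstructible g →
      ConnectedSpace (Reeb f) → ConnectedSpace (Reeb g) →
      ∀ (v₀ v₁ : Reeb f) (u₀ u₁ : Reeb g),
        (∀ x, reebFun f v₀ ≤ reebFun f x) → (∀ x, reebFun f x ≤ reebFun f v₁) →
        (∀ y, reebFun g u₀ ≤ reebFun g y) → (∀ y, reebFun g y ≤ reebFun g u₁) →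
        ENNReal.ofReal (max |reebFun f v₁ - reebFun g u₁| |reebFun f v₀ - reebFun g u₀|) ≤
          reebFunctionalDistortion f g) ∧
    ¬ ∃ c : ℝ≥0, ∀ (X : Type u) [TopologicalSpace X] [PathConnectedSpace X] (f g : C(X, ℝ)),
      IsConstructible f → IsConstructible g →
        reebBottleneckExtZero k f g = c * reebFunctionalDistortion f g := by
  refine ⟨fun X Y _ _ f g hf hg => ?_, fun X Y _ _ f g hf hg _ _ v₀ v₁ u₀ u₁ hv₀ hv₁ hu₀ hu₁ => ?_,
    ?_⟩
  · have := hf.compactSpace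
    have := hf.locallyPathConnectedSpace
    have := hg.compactSpace
    have := hg.locallyPathConnectedSpace
    exact bottleneckDist_extZero_le_functionalDistortion k _ _
  · have := hf.locallyPathConnectedSpace
    have := hg.locallyPathConnectedSpace
    have : PathConnectedSpace (Reeb f) := pathConnectedSpace_iff_connectedSpace.2 ‹_›
    have : PathConnectedSpace (Reeb g) := pathConnectedSpace_iff_connectedSpace.2 ‹_›
    exact ofReal_max_le_functionalDistortion _ _ hv₀ hv₁ hu₀ hu₁
  -- A pair at bottleneck distance `0` but positive distortion forces `c = 0`; a pair at positive
  -- bottleneck distance excludes it.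
  · rintro ⟨c, hc⟩
    have h := hc LiftedInterval coordFun veeFun isConstructible_coordFun isConstructible_veeFun
    rw [bottleneckDist_coordFun_veeFun, eq_comm, mul_eq_zero] at h
    have hc0 := h.resolve_right functionalDistortion_coordFun_veeFun_ne_zero
    refine bottleneckDist_coordFun_const_ne_zero k ?_
    rw [hc _ _ _ isConstructible_coordFun (isConstructible_const 0), hc0, zero_mul]
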